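/- Let $\mathcal V,\mathcal H$ be groupoids with the same set of objects $\mathcal P$ (products written in diagrammatic order), with source and end maps $t,b:\mathcal V\to\mathcal P$ and $l,r:\mathcal H\to\mathcal P$. A \emph{matched pair} $(\mathcal V,\mathcal H)$ consists of a left action $x\triangleright g\in\mathcal V$ of $\mathcal H$ on $t:\mathcal V\to\mathcal P$ and a right action $x\triangleleft g\in\mathcal H$ of $\mathcal V$ on $r:\mathcal H\to\mathcal P$, both defined for $r(x)=t(g)$, such that $b(x\triangleright g)=l(x\triangleleft g)$, $x\triangleright fg=(x\triangleright f)\bigl((x\triangleleft f)\triangleright g\bigr)$ and $xy\triangleleft g=\bigl(x\triangleleft(y\triangleright g)\bigr)(y\triangleleft g)$ whenever defined. Its \emph{dual} is the matched pair $(\mathcal H,\mathcal V)$ with actions $f\rightharpoonup y=(y^{-1}\triangleleft f^{-1})^{-1}$ and $f\leftharpoonup y=(y^{-1}\triangleright f^{-1})^{-1}$ for $f\in\mathcal V$, $y\in\mathcal H$, $b(f)=l(y)$. $\operatorname{Quiv}(\mathcal P)$ is the monoidal category of sets $E$ with two maps $p,q:E\to\mathcal P$, with tensor product $E\otimes F=\{(e,f):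 q(e)=p(f)\}$, $p(e,f)=p(e)$, $q(e,f)=q(f)$, and unit $\mathcal P$ with $p=q=\mathrm{id}$. $\operatorname{Rep}(\mathcal V,\mathcal H)$ is the monoidal category of quivers $E$ over $\mathcal P$ with a left action of $\mathcal H$ on $p$ and a grading $|\cdot|:E\to\mathcal V$ such that $p(e)=t(|e|)$, $q(e)=b(|e|)$ and $|x\triangleright e|=x\triangleright|e|$; morphisms are the maps preserving action and grading, the tensor product is $E\otimes F$ as above with $x\triangleright(e,f)=\bigl(x\triangleright e,(x\triangleleft|e|)\triangleright f\bigr)$ and $|(e,f)|=|e||f|$, and the unit is $\mathcal P$ with $x\triangleright r(x)=l(x)$ and $|P|=\mathrm{id}_{\mathcal V}P$. Let $f\!\ell:\operatorname{Rep}(\mathcal V,\mathcal H)\to\operatorname{Quiv}(\mathcal P)$ be the forgetful functor; it is monoidal. The \emph{centralizer} $Z(F)$ of a monoidal functor $F:\mathcal C\to\mathcal D$ is the monoidal category of pairs $(D,\zeta)$ with $D$ an object of $\mathcal D$ and $\zeta_X:F(X)\otimes D\to D\otimes F(X)$ a natural isomorphism with $\zeta_{X\otimes Y}=(\zeta_X\otimes\mathrm{id})(\mathrm{id}\otimes\zeta_Y)$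 and $\zeta_{\mathbf 1}=\mathrm{id}$ (up to the canonical isomorphisms of $F$ and $\mathcal D$); morphisms are the morphisms of $\mathcal D$ that commute with the $\zeta$'s, the tensor product is $(D,\zeta)\otimes(E,\vartheta)=\bigl(D\otimes E,(\mathrm{id}\otimes\vartheta)(\zeta\otimes\mathrm{id})\bigr)$, and the unit is $(\mathbf 1,\mathrm{id})$. Let $U:Z(F)\to\mathcal D$, $U(D,\zeta)=D$. \textbf{Corollary.} Let $(\mathcal V,\mathcal H)$ be a matched pair of groupoids with base $\mathcal P$. There is a strict monoidal equivalence \[\operatorname{Rep}(\mathcal H,\mathcal V)\;\cong\; Z(f\!\ell)\] between the category of representations of the dual matched pair and the centralizer of the forgetful functor $f\!\ell:\operatorname{Rep}(\mathcal V,\mathcal H)\to\operatorname{Quiv}(\mathcal P)$ (the functors in both directions are strict monoidal, and the unit and counit are monoidal). Moreover, its composite $\operatorname{Rep}(\mathcal H,\mathcal V)\to Z(f\!\ell)\xrightarrow{U}\operatorname{Quiv}(\mathcal P)$ is equal to the forgetful functor $f\!\ell:\operatorname{Rep}(\mathcal H,\mathcal V)\to\operatorname{Quiv}(\mathcal P)$.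 -/

import Mathlib

universe u

namespace CategoryTheory

open MonoidalCategory Functor.LaxMonoidal Functor.OplaxMonoidal

universe v₁ v₂ u₁ u₂

/-! ### Strict monoidal functors and strict monoidal equivalences -/

/-- A monoidal functor is strict when its structural isomorphisms `𝟙_ D ≅ F.obj (𝟙_ C)` and
`F.obj X ⊗ F.obj Y ≅ F.obj (X ⊗ Y)` are identities: source and target coincide, and the
isomorphism is the one coming from that equality. -/
structure IsStrictMonoidal {C : Type u₁} [Category.{v₁} C] [MonoidalCategory C]
    {D : Type u₂} [Category.{v₂} D] [MonoidalCategory D] (F : C ⥤ D) [F.Monoidal] : Prop where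
  unit_obj : 𝟙_ D = F.obj (𝟙_ C)
  ε_eq : ε F = eqToHom unit_obj
  tensor_obj : ∀ X Y : C, F.obj X ⊗ F.obj Y = F.obj (X ⊗ Y)
  μ_eq : ∀ X Y : C, μ F X Y = eqToHom (tensor_obj X Y)

/-- A strict monoidal equivalence: a monoidal equivalence (the unit and counit being monoidal
natural isomorphisms) in which the functors in both directions are strict monoidal. -/
structure StrictMonoidalEquivalence (C : Type u₁) [Category.{v₁} C] [MonoidalCategory C]
    (D : Type u₂) [Category.{v₂} D] [MonoidalCategory D] where
  equiv : C ≌ D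
  functorMonoidal : equiv.functor.Monoidal
  inverseMonoidal : equiv.inverse.Monoidal
  isMonoidal : equiv.IsMonoidal
  functor_strict : IsStrictMonoidal equiv.functor
  inverse_strict : IsStrictMonoidal equiv.inverse

/-! ### The centralizer of a monoidal functor -/

/-- An object of the centralizer of a monoidal functor `F : C ⥤ D`: an object `obj` of `D` with a
natural isomorphism `ζ : F(-) ⊗ obj ≅ obj ⊗ F(-)` compatible with tensor products and units. -/
structure Centralizer {C : Type u₁} [Category.{v₁} C] [MonoidalCategory C]
    {D : Type u₂} [Category.{v₂} D] [MonoidalCategory D] (F : C ⥤ D) [F.Monoidal] where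
  obj : D
  ζ : ∀ X : C, F.obj X ⊗ obj ≅ obj ⊗ F.obj X
  naturality : ∀ {X Y : C} (f : X ⟶ Y),
    F.map f ▷ obj ≫ (ζ Y).hom = (ζ X).hom ≫ obj ◁ F.map f
  tensor : ∀ X Y : C, (ζ (X ⊗ Y)).hom =
    δ F X Y ▷ obj ≫ (α_ (F.obj X) (F.obj Y) obj).hom ≫ F.obj X ◁ (ζ Y).hom ≫
      (α_ (F.obj X) obj (F.obj Y)).inv ≫ (ζ X).hom ▷ F.obj Y ≫
      (α_ obj (F.obj X) (F.obj Y)).hom ≫ obj ◁ μ F X Y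
  unit : (ζ (𝟙_ C)).hom = η F ▷ obj ≫ (λ_ obj).hom ≫ (ρ_ obj).inv ≫ obj ◁ ε F

namespace Centralizer

section

variable {C : Type u₁} [Category.{v₁} C] [MonoidalCategory C]
  {D : Type u₂} [Category.{v₂} D] [MonoidalCategory D] {F : C ⥤ D} [F.Monoidal]

/-- A morphism in the centralizer: a morphism in `D` which commutes with the `ζ`s. -/
@[ext]
structure Hom (A B : Centralizer F) where
  hom : A.obj ⟶ B.obj
  comm : ∀ X : C, F.obj X ◁ hom ≫ (B.ζ X).hom = (A.ζ X).hom ≫ hom ▷ F.obj X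

instance : Category (Centralizer F) where
  Hom := Hom
  id A := { hom := 𝟙 A.obj, comm := fun X => by simp }
  comp f g :=
    { hom := f.hom ≫ g.hom
      comm := fun X => by
        rw [MonoidalCategory.whiskerLeft_comp, Category.assoc, g.comm, ← Category.assoc, f.comm,
          Category.assoc, comp_whiskerRight] }
  id_comp f := Hom.ext (Category.id_comp _)
  comp_id f := Hom.ext (Category.comp_id _)
  assoc f g h := Hom.ext (Category.assoc _ _ _)

@[ext]
theorem hom_ext {A B : Centralizer F} (f g : A ⟶ B) (h : f.hom = g.hom) : f = g := Hom.ext h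

@[simp]
theorem id_hom (A : Centralizer F) : Hom.hom (𝟙 A) = 𝟙 A.obj := rfl

@[simp]
theorem comp_hom {A B E : Centralizer F} (f : A ⟶ B) (g : B ⟶ E) :
    (f ≫ g).hom = f.hom ≫ g.hom := rfl

/-- The forgetful functor from the centralizer of `F : C ⥤ D` to `D`. -/
@[simps]
def forget (F : C ⥤ D) [F.Monoidal] : Centralizer F ⥤ D where
  obj A := A.obj
  map f := f.hom

/-- A morphism of the centralizer whose underlying morphism is invertible is invertible. -/
@[simps]
def isoMk {A B : Centralizer F} (f : A.obj ≅ B.obj)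
    (comm : ∀ X : C, F.obj X ◁ f.hom ≫ (B.ζ X).hom = (A.ζ X).hom ≫ f.hom ▷ F.obj X) :
    A ≅ B where
  hom := { hom := f.hom, comm := comm }
  inv :=
    { hom := f.inv
      comm := fun X => by
        rw [← cancel_epi (F.obj X ◁ f.hom), ← Category.assoc, ← Category.assoc, comm]
        simp }

/-- The natural isomorphism `(id ⊗ ϑ) ∘ (ζ ⊗ id) : F(-) ⊗ D ⊗ E ≅ D ⊗ E ⊗ F(-)` attached to
`(D, ζ)` and `(E, ϑ)`. -/
def tensorζ (A B : Centralizer F) (X : C) :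
    F.obj X ⊗ (A.obj ⊗ B.obj) ≅ (A.obj ⊗ B.obj) ⊗ F.obj X :=
  (α_ (F.obj X) A.obj B.obj).symm ≪≫ whiskerRightIso (A.ζ X) B.obj ≪≫
    α_ A.obj (F.obj X) B.obj ≪≫ whiskerLeftIso A.obj (B.ζ X) ≪≫
    (α_ A.obj B.obj (F.obj X)).symm

theorem tensorζ_hom (A B : Centralizer F) (X : C) :
    (tensorζ A B X).hom = (α_ (F.obj X) A.obj B.obj).inv ≫ (A.ζ X).hom ▷ B.obj ≫
      (α_ A.obj (F.obj X) B.obj).hom ≫ A.obj ◁ (B.ζ X).hom ≫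
      (α_ A.obj B.obj (F.obj X)).inv := rfl

/-- The tensor product of two objects of the centralizer. -/
def tensorObj (A B : Centralizer F) : Centralizer F where
  obj := A.obj ⊗ B.obj
  ζ := tensorζ A B
  naturality {X Y} f := by
    simp only [tensorζ_hom]
    calc
      _ = 𝟙 _ ⊗≫ (F.map f ▷ A.obj ≫ (A.ζ Y).hom) ▷ B.obj ⊗≫
            A.obj ◁ (B.ζ Y).hom ⊗≫ 𝟙 _ := by monoidal
      _ = 𝟙 _ ⊗≫ (A.ζ X).hom ▷ B.obj ⊗≫
            A.obj ◁ (F.map f ▷ B.obj ≫ (B.ζ Y).hom) ⊗≫ 𝟙 _ := by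
        rw [A.naturality]; monoidal
      _ = _ := by rw [B.naturality]; monoidal
  tensor X Y := by
    simp only [tensorζ_hom]
    rw [A.tensor, B.tensor]
    calc
      _ = 𝟙 _ ⊗≫ δ F X Y ▷ (A.obj ⊗ B.obj) ⊗≫ F.obj X ◁ (A.ζ Y).hom ▷ B.obj ⊗≫
            (A.ζ X).hom ▷ F.obj Y ▷ B.obj ⊗≫
            A.obj ◁ (μ F X Y ≫ δ F X Y) ▷ B.obj ⊗≫
            A.obj ◁ F.obj X ◁ (B.ζ Y).hom ⊗≫ A.obj ◁ (B.ζ X).hom ▷ F.obj Y ⊗≫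
            (A.obj ⊗ B.obj) ◁ μ F X Y := by monoidal
      _ = 𝟙 _ ⊗≫ δ F X Y ▷ (A.obj ⊗ B.obj) ⊗≫ F.obj X ◁ (A.ζ Y).hom ▷ B.obj ⊗≫
            ((A.ζ X).hom ▷ (F.obj Y ⊗ B.obj) ≫ (A.obj ⊗ F.obj X) ◁ (B.ζ Y).hom) ⊗≫
            A.obj ◁ (B.ζ X).hom ▷ F.obj Y ⊗≫
            (A.obj ⊗ B.obj) ◁ μ F X Y := by
        rw [Functor.Monoidal.μ_δ]; monoidal
      _ = _ := by rw [← whisker_exchange]; monoidal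
  unit := by
    simp only [tensorζ_hom]
    rw [A.unit, B.unit]
    calc
      _ = 𝟙 _ ⊗≫ η F ▷ (A.obj ⊗ B.obj) ⊗≫ A.obj ◁ (ε F ≫ η F) ▷ B.obj ⊗≫
            (A.obj ⊗ B.obj) ◁ ε F := by monoidal
      _ = _ := by rw [Functor.Monoidal.ε_η]; monoidal

/-- The unit object of the centralizer: the unit of `D` with the identity transformation (up to
the unit isomorphisms of `D`). -/
def tensorUnit (F : C ⥤ D) [F.Monoidal] : Centralizer F where
  obj := 𝟙_ D
  ζ X := ρ_ (F.obj X) ≪≫ (λ_ (F.obj X)).symm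
  naturality f := by simp
  tensor X Y := by
    dsimp
    calc
      _ = 𝟙 _ ⊗≫ (δ F X Y ≫ μ F X Y) ⊗≫ 𝟙 _ := by rw [Functor.Monoidal.δ_μ]; monoidal
      _ = _ := by monoidal
  unit := by
    dsimp
    calc
      _ = 𝟙 _ ⊗≫ (η F ≫ ε F) ⊗≫ 𝟙 _ := by rw [Functor.Monoidal.η_ε]; monoidal
      _ = _ := by monoidal

/-- The tensor product of morphisms is that of `D`. -/
def tensorHom {A A' B B' : Centralizer F} (f : A ⟶ A') (g : B ⟶ B') :
    tensorObj A B ⟶ tensorObj A' B' where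
  hom := f.hom ⊗ₘ g.hom
  comm X := by
    change F.obj X ◁ (f.hom ⊗ₘ g.hom) ≫ (tensorζ A' B' X).hom =
      (tensorζ A B X).hom ≫ (f.hom ⊗ₘ g.hom) ▷ F.obj X
    simp only [tensorζ_hom]
    calc
      _ = 𝟙 _ ⊗≫ (F.obj X ⊗ A.obj) ◁ g.hom ⊗≫
            (F.obj X ◁ f.hom ≫ (A'.ζ X).hom) ▷ B'.obj ⊗≫
            A'.obj ◁ (B'.ζ X).hom ⊗≫ 𝟙 _ := by rw [tensorHom_def']; monoidal
      _ = 𝟙 _ ⊗≫ ((F.obj X ⊗ A.obj) ◁ g.hom ≫ (A.ζ X).hom ▷ B'.obj) ⊗≫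
            (f.hom ▷ (F.obj X ⊗ B'.obj) ≫ A'.obj ◁ (B'.ζ X).hom) ⊗≫ 𝟙 _ := by
        rw [f.comm]; monoidal
      _ = 𝟙 _ ⊗≫ (A.ζ X).hom ▷ B.obj ⊗≫
            A.obj ◁ (F.obj X ◁ g.hom ≫ (B'.ζ X).hom) ⊗≫
            f.hom ▷ (B'.obj ⊗ F.obj X) ⊗≫ 𝟙 _ := by
        rw [whisker_exchange (A.ζ X).hom g.hom, ← whisker_exchange f.hom (B'.ζ X).hom]; monoidal
      _ = _ := by rw [g.comm, tensorHom_def']; monoidal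

instance : MonoidalCategoryStruct (Centralizer F) where
  tensorObj := tensorObj
  tensorHom := tensorHom
  whiskerLeft A _ _ f := tensorHom (𝟙 A) f
  whiskerRight f A := tensorHom f (𝟙 A)
  tensorUnit := tensorUnit F
  associator A B E := isoMk (α_ A.obj B.obj E.obj) (fun X => by
    change F.obj X ◁ (α_ A.obj B.obj E.obj).hom ≫ (tensorζ A (tensorObj B E) X).hom =
      (tensorζ (tensorObj A B) E X).hom ≫ (α_ A.obj B.obj E.obj).hom ▷ F.obj X
    rw [tensorζ_hom, tensorζ_hom]
    change _ ≫ _ ≫ _ ≫ _ ≫ A.obj ◁ (tensorζ B E X).hom ≫ _ =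
      (_ ≫ (tensorζ A B X).hom ▷ E.obj ≫ _ ≫ _ ≫ _) ≫ _
    rw [tensorζ_hom, tensorζ_hom]
    change _ ◁ _ ≫ (α_ (F.obj X) A.obj (B.obj ⊗ E.obj)).inv ≫ (A.ζ X).hom ▷ (B.obj ⊗ E.obj) ≫
        (α_ A.obj (F.obj X) (B.obj ⊗ E.obj)).hom ≫ _ ≫
          (α_ A.obj (B.obj ⊗ E.obj) (F.obj X)).inv =
      ((α_ (F.obj X) (A.obj ⊗ B.obj) E.obj).inv ≫ _ ≫
        (α_ (A.obj ⊗ B.obj) (F.obj X) E.obj).hom ≫ (A.obj ⊗ B.obj) ◁ (E.ζ X).hom ≫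
          (α_ (A.obj ⊗ B.obj) E.obj (F.obj X)).inv) ≫ _
    monoidal)
  leftUnitor A := isoMk (λ_ A.obj) (fun X => by
    change F.obj X ◁ (λ_ A.obj).hom ≫ (A.ζ X).hom =
      ((α_ (F.obj X) (𝟙_ D) A.obj).inv ≫ ((ρ_ (F.obj X)).hom ≫ (λ_ (F.obj X)).inv) ▷ A.obj ≫
        (α_ (𝟙_ D) (F.obj X) A.obj).hom ≫ 𝟙_ D ◁ (A.ζ X).hom ≫
          (α_ (𝟙_ D) A.obj (F.obj X)).inv) ≫ (λ_ A.obj).hom ▷ F.obj X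
    monoidal)
  rightUnitor A := isoMk (ρ_ A.obj) (fun X => by
    change F.obj X ◁ (ρ_ A.obj).hom ≫ (A.ζ X).hom =
      ((α_ (F.obj X) A.obj (𝟙_ D)).inv ≫ (A.ζ X).hom ▷ 𝟙_ D ≫
        (α_ A.obj (F.obj X) (𝟙_ D)).hom ≫
          A.obj ◁ ((ρ_ (F.obj X)).hom ≫ (λ_ (F.obj X)).inv) ≫
            (α_ A.obj (𝟙_ D) (F.obj X)).inv) ≫ (ρ_ A.obj).hom ▷ F.obj X
    monoidal)

instance : MonoidalCategory (Centralizer F) where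
  tensorHom_def f g := hom_ext _ _ (by
    change f.hom ⊗ₘ g.hom = (f.hom ⊗ₘ 𝟙 _) ≫ (𝟙 _ ⊗ₘ g.hom)
    simp [MonoidalCategory.tensorHom_def])
  id_tensorHom_id A B := hom_ext _ _ (by
    change 𝟙 A.obj ⊗ₘ 𝟙 B.obj = 𝟙 _
    simp)
  tensorHom_comp_tensorHom f₁ f₂ g₁ g₂ := hom_ext _ _ (by
    change (f₁.hom ⊗ₘ f₂.hom) ≫ (g₁.hom ⊗ₘ g₂.hom) = (f₁.hom ≫ g₁.hom) ⊗ₘ (f₂.hom ≫ g₂.hom)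
    simp)
  whiskerLeft_id A B := hom_ext _ _ (by
    change 𝟙 A.obj ⊗ₘ 𝟙 B.obj = 𝟙 _
    simp)
  id_whiskerRight A B := hom_ext _ _ (by
    change 𝟙 A.obj ⊗ₘ 𝟙 B.obj = 𝟙 _
    simp)
  associator_naturality f₁ f₂ f₃ := hom_ext _ _ (by
    exact associator_naturality f₁.hom f₂.hom f₃.hom)
  leftUnitor_naturality f := hom_ext _ _ (by
    change (𝟙 _ ⊗ₘ f.hom) ≫ (λ_ _).hom = (λ_ _).hom ≫ f.hom
    simp)
  rightUnitor_naturality f := hom_ext _ _ (by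
    change (f.hom ⊗ₘ 𝟙 _) ≫ (ρ_ _).hom = (ρ_ _).hom ≫ f.hom
    simp)
  pentagon A B E G := hom_ext _ _ (by
    change ((α_ A.obj B.obj E.obj).hom ⊗ₘ 𝟙 G.obj) ≫ (α_ _ _ _).hom ≫
      (𝟙 A.obj ⊗ₘ (α_ B.obj E.obj G.obj).hom) = (α_ _ _ _).hom ≫ (α_ _ _ _).hom
    simp)
  triangle A B := hom_ext _ _ (by
    change (α_ A.obj (𝟙_ D) B.obj).hom ≫ (𝟙 A.obj ⊗ₘ (λ_ B.obj).hom) =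
      (ρ_ A.obj).hom ⊗ₘ 𝟙 B.obj
    simp)

end

end Centralizer

end CategoryTheory

namespace MatchedPairs

open CategoryTheory MonoidalCategory

/-! ### The monoidal category of quivers over a set -/

/-- A quiver over `P`: a set with two maps to `P`. -/
structure QuivOver (P : Type u) : Type (u + 1) where
  carrier : Type u
  p : carrier → P
  q : carrier → P

namespace QuivOver

/-- A morphism of quivers over `P`: a map commuting with `p` and `q`. -/
@[ext]
structure Hom {P : Type u} (X Y : QuivOver P) where
  toFun : X.carrier → Y.carrier
  p_comm : ∀ x, Y.p (toFun x) = X.p x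
  q_comm : ∀ x, Y.q (toFun x) = X.q x

instance {P : Type u} : Category (QuivOver P) where
  Hom := Hom
  id X := { toFun := fun x => x, p_comm := fun _ => rfl, q_comm := fun _ => rfl }
  comp f g :=
    { toFun := fun x => g.toFun (f.toFun x)
      p_comm := fun x => (g.p_comm _).trans (f.p_comm x)
      q_comm := fun x => (g.q_comm _).trans (f.q_comm x) }

@[ext]
theorem hom_ext {P : Type u} {X Y : QuivOver P} (f g : X ⟶ Y)
    (h : ∀ x, f.toFun x = g.toFun x) : f = g := Hom.ext (funext h)

@[simp]
theorem id_toFun {P : Type u} (X : QuivOver P) (x : X.carrier) : Hom.toFun (𝟙 X) x = x := rfl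

@[simp]
theorem comp_toFun {P : Type u} {X Y Z : QuivOver P} (f : X ⟶ Y) (g : Y ⟶ Z) (x : X.carrier) :
    (f ≫ g).toFun x = g.toFun (f.toFun x) := rfl

/-- The tensor product: pairs `(x, y)` with `q x = p y`. -/
def tensorObj {P : Type u} (X Y : QuivOver P) : QuivOver P where
  carrier := {z : X.carrier × Y.carrier // X.q z.1 = Y.p z.2}
  p z := X.p z.1.1
  q z := Y.q z.1.2

/-- The tensor product of morphisms. -/
def tensorHom {P : Type u} {X X' Y Y' : QuivOver P} (f : X ⟶ X') (g : Y ⟶ Y') :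
    tensorObj X Y ⟶ tensorObj X' Y' where
  toFun z := ⟨(f.toFun z.1.1, g.toFun z.1.2),
    (f.q_comm _).trans (z.2.trans (g.p_comm _).symm)⟩
  p_comm z := f.p_comm z.1.1
  q_comm z := g.q_comm z.1.2

/-- The unit quiver `P`, with `p = q = id`. -/
def tensorUnit (P : Type u) : QuivOver P where
  carrier := P
  p := fun A => A
  q := fun A => A

/-- The canonical bijection `((x, y), z) ↦ (x, (y, z))`. -/
def associator {P : Type u} (X Y Z : QuivOver P) :
    tensorObj (tensorObj X Y) Z ≅ tensorObj X (tensorObj Y Z) where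
  hom :=
    { toFun := fun w => ⟨(w.1.1.1.1, ⟨(w.1.1.1.2, w.1.2), w.2⟩), w.1.1.2⟩
      p_comm := fun _ => rfl
      q_comm := fun _ => rfl }
  inv :=
    { toFun := fun w => ⟨(⟨(w.1.1, w.1.2.1.1), w.2⟩, w.1.2.1.2), w.1.2.2⟩
      p_comm := fun _ => rfl
      q_comm := fun _ => rfl }
  hom_inv_id := rfl
  inv_hom_id := rfl

/-- The canonical bijection `(A, x) ↦ x`. -/
def leftUnitor {P : Type u} (X : QuivOver P) : tensorObj (tensorUnit P) X ≅ X where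
  hom :=
    { toFun := fun w => w.1.2
      p_comm := fun w => w.2.symm
      q_comm := fun _ => rfl }
  inv :=
    { toFun := fun x => ⟨(X.p x, x), rfl⟩
      p_comm := fun _ => rfl
      q_comm := fun _ => rfl }
  hom_inv_id := hom_ext _ _ (fun w => Subtype.ext (Prod.ext w.2.symm rfl))
  inv_hom_id := rfl

/-- The canonical bijection `(x, A) ↦ x`. -/
def rightUnitor {P : Type u} (X : QuivOver P) : tensorObj X (tensorUnit P) ≅ X where
  hom :=
    { toFun := fun w => w.1.1
      p_comm := fun _ => rfl
      q_comm := fun w => w.2 }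
  inv :=
    { toFun := fun x => ⟨(x, X.q x), rfl⟩
      p_comm := fun _ => rfl
      q_comm := fun _ => rfl }
  hom_inv_id := hom_ext _ _ (fun w => Subtype.ext (Prod.ext rfl w.2))
  inv_hom_id := rfl

instance {P : Type u} : MonoidalCategory (QuivOver P) where
  tensorObj := tensorObj
  tensorHom := tensorHom
  whiskerLeft X _ _ f := tensorHom (𝟙 X) f
  whiskerRight f X := tensorHom f (𝟙 X)
  tensorUnit := tensorUnit P
  associator := associator
  leftUnitor := leftUnitor
  rightUnitor := rightUnitor
  tensorHom_def _ _ := rfl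
  id_tensorHom_id _ _ := rfl
  tensorHom_comp_tensorHom _ _ _ _ := rfl
  whiskerLeft_id _ _ := rfl
  id_whiskerRight _ _ := rfl
  associator_naturality _ _ _ := rfl
  leftUnitor_naturality _ := rfl
  rightUnitor_naturality _ := rfl
  pentagon _ _ _ _ := rfl
  triangle _ _ := rfl

end QuivOver

/-! ### Groupoids with base `P`: arrows, partial product, actions

The base of a groupoid is its set of objects, so a groupoid with base `P` is a term of
`Groupoid P`. Products are in diagrammatic order. -/

/-- The set of all arrows of a groupoid with base `P`. -/
@[ext]
structure Arr {P : Type u} (G : Groupoid.{u} P) : Type u where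
  src : P
  tgt : P
  hom : src ⟶ tgt

namespace Arr

/-- The identity arrow at a point of the base. -/
def one {P : Type u} (G : Groupoid.{u} P) (A : P) : Arr G := ⟨A, A, 𝟙 A⟩

/-- The product `x y` of composable arrows (first `x`, then `y`). -/
def mul {P : Type u} {G : Groupoid.{u} P} (x y : Arr G) (h : x.tgt = y.src) : Arr G :=
  ⟨x.src, y.tgt, x.hom ≫ eqToHom h ≫ y.hom⟩

/-- The inverse arrow. -/
def inv {P : Type u} {G : Groupoid.{u} P} (x : Arr G) : Arr G :=
  ⟨x.tgt, x.src, Groupoid.inv x.hom⟩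

theorem mul_congr {P : Type u} {G : Groupoid.{u} P} {x x' y y' : Arr G} (hx : x = x')
    (hy : y = y') (h : x.tgt = y.src) : x.mul y h = x'.mul y' (hx ▸ hy ▸ h) := by
  subst hx; subst hy; rfl

theorem mul_assoc {P : Type u} {G : Groupoid.{u} P} (x y z : Arr G)
    (hxy : x.tgt = y.src) (hyz : y.tgt = z.src) :
    (x.mul y hxy).mul z hyz = x.mul (y.mul z hyz) hxy := by
  simp [mul]

theorem one_mul {P : Type u} {G : Groupoid.{u} P} (x : Arr G) {A : P} (h : A = x.src) :
    (one G A).mul x h = x := by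
  subst h; simp [mul, one]

theorem mul_one {P : Type u} {G : Groupoid.{u} P} (x : Arr G) {A : P} (h : x.tgt = A) :
    x.mul (one G A) h = x := by
  subst h; simp [mul, one]

theorem inv_mul {P : Type u} {G : Groupoid.{u} P} (x : Arr G) :
    x.inv.mul x rfl = one G x.tgt := by
  simp [mul, one, inv]

theorem mul_inv {P : Type u} {G : Groupoid.{u} P} (x : Arr G) :
    x.mul x.inv rfl = one G x.src := by
  simp [mul, one, inv]

theorem inv_inv {P : Type u} {G : Groupoid.{u} P} (x : Arr G) : x.inv.inv = x := by
  simp [inv]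

theorem inv_one {P : Type u} (G : Groupoid.{u} P) (A : P) : (one G A).inv = one G A := by
  simp [inv, one]

theorem mul_inv_rev {P : Type u} {G : Groupoid.{u} P} (x y : Arr G) (h : x.tgt = y.src) :
    (x.mul y h).inv = y.inv.mul x.inv h.symm := by
  obtain ⟨A, B, f⟩ := x
  obtain ⟨B', D, g⟩ := y
  obtain rfl : B = B' := h
  simp [mul, inv]

theorem eq_one_of_mul_self {P : Type u} {G : Groupoid.{u} P} (x : Arr G) (h : x.tgt = x.src)
    (hx : x.mul x h = x) : x = one G x.src := by
  have h1 : x.inv.mul (x.mul x h) rfl = x.inv.mul x rfl := mul_congr rfl hx rfl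
  have h2 : (x.inv.mul x rfl).mul x h = x := (mul_congr x.inv_mul rfl h).trans (one_mul x h)
  exact h2.symm.trans ((mul_assoc _ _ _ rfl h).trans
    (h1.trans (x.inv_mul.trans (congrArg (one G) h))))

end Arr

/-- A left action of a groupoid on a map `p : E → P`. -/
structure LeftAction {P : Type u} (G : Groupoid.{u} P) {E : Type u} (p : E → P) : Type u where
  act : (g : Arr G) → (e : E) → g.tgt = p e → E
  p_act : ∀ (g : Arr G) (e : E) (h : g.tgt = p e), p (act g e h) = g.src
  act_act : ∀ (g k : Arr G) (e : E) (hgk : g.tgt = k.src) (h : k.tgt = p e),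
    act g (act k e h) (hgk.trans (p_act k e h).symm) = act (g.mul k hgk) e h
  one_act : ∀ e : E, act (Arr.one G (p e)) e rfl = e

theorem LeftAction.congr {P : Type u} {G : Groupoid.{u} P} {E : Type u} {p : E → P}
    (a : LeftAction G p) {g g' : Arr G} {e e' : E} (hg : g = g') (he : e = e')
    (h : g.tgt = p e) : a.act g e h = a.act g' e' (hg ▸ he ▸ h) := by
  subst hg; subst he; rfl

theorem LeftAction.act_of_eq_one {P : Type u} {G : Groupoid.{u} P} {E : Type u} {p : E → P}
    (a : LeftAction G p) {g : Arr G} {e : E} {A : P} (hg : g = Arr.one G A) (h : g.tgt = p e) :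
    a.act g e h = e := by
  subst hg
  obtain rfl : A = p e := h
  exact a.one_act e

/-- A right action of a groupoid on a map `q : E → P`. -/
structure RightAction {P : Type u} (G : Groupoid.{u} P) {E : Type u} (q : E → P) : Type u where
  act : (e : E) → (g : Arr G) → q e = g.src → E
  q_act : ∀ (e : E) (g : Arr G) (h : q e = g.src), q (act e g h) = g.tgt
  act_act : ∀ (e : E) (g k : Arr G) (h : q e = g.src) (hgk : g.tgt = k.src),
    act (act e g h) k ((q_act e g h).trans hgk) = act e (g.mul k hgk) h
  act_one : ∀ e : E, act e (Arr.one G (q e)) rfl = e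

theorem RightAction.congr {P : Type u} {G : Groupoid.{u} P} {E : Type u} {q : E → P}
    (a : RightAction G q) {g g' : Arr G} {e e' : E} (he : e = e') (hg : g = g')
    (h : q e = g.src) : a.act e g h = a.act e' g' (hg ▸ he ▸ h) := by
  subst hg; subst he; rfl

/-! ### Matched pairs of groupoids -/

/-- A matched pair of groupoids `(V, H)` with base `P`: a left action `x ▷ g` of the horizontal
groupoid `H` on the source map of the vertical groupoid `V`, and a right action `x ◁ g` of `V` on
the end map of `H`, both defined when the end of `x` is the source of `g`. -/
structure MatchedPair {P : Type u} (V H : Groupoid.{u} P) : Type u where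
  left : LeftAction H (Arr.src : Arr V → P)
  right : RightAction V (Arr.tgt : Arr H → P)
  corner : ∀ (x : Arr H) (g : Arr V) (h : x.tgt = g.src),
    (left.act x g h).tgt = (right.act x g h).src
  left_mul : ∀ (x : Arr H) (f g : Arr V) (h : x.tgt = f.src) (hfg : f.tgt = g.src),
    left.act x (f.mul g hfg) h =
      (left.act x f h).mul (left.act (right.act x f h) g ((right.q_act x f h).trans hfg))
        ((corner x f h).trans (left.p_act _ _ _).symm)
  right_mul : ∀ (x y : Arr H) (g : Arr V) (hxy : x.tgt = y.src) (h : y.tgt = g.src),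
    right.act (x.mul y hxy) g h =
      (right.act x (left.act y g h) (hxy.trans (left.p_act y g h).symm)).mul
        (right.act y g h) ((right.q_act _ _ _).trans (corner y g h))

namespace MatchedPair

theorem right_one {P : Type u} {V H : Groupoid.{u} P} (M : MatchedPair V H) (x : Arr H) {A : P}
    (h : x.tgt = A) : M.right.act x (Arr.one V A) h = x := by
  subst h
  exact M.right.act_one x

theorem left_one {P : Type u} {V H : Groupoid.{u} P} (M : MatchedPair V H) (x : Arr H) {A : P}
    (h : x.tgt = A) : M.left.act x (Arr.one V A) h = Arr.one V x.src := by
  have h1 := M.left_mul x (Arr.one V A) (Arr.one V A) h rfl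
  have h2 : M.left.act x (Arr.one V A) h =
      (M.left.act x (Arr.one V A) h).mul (M.left.act x (Arr.one V A) h)
        ((M.corner x (Arr.one V A) h).trans
          ((congrArg Arr.src (M.right_one x h)).trans (M.left.p_act _ _ _).symm)) :=
    (M.left.congr rfl (Arr.one_mul (Arr.one V A) rfl).symm h).trans
      (h1.trans (Arr.mul_congr rfl (M.left.congr (M.right_one x h) rfl _) _))
  exact (Arr.eq_one_of_mul_self _ _ h2.symm).trans (congrArg (Arr.one V) (M.left.p_act _ _ _))

/-- In the matched pair `(V, H)`, the identity of `H` is carried by `◁` to an identity. -/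
theorem one_right {P : Type u} {V H : Groupoid.{u} P} (M : MatchedPair V H) (g : Arr V) {A : P}
    (h : A = g.src) : M.right.act (Arr.one H A) g h = Arr.one H g.tgt := by
  have h0 : M.left.act (Arr.one H A) g h = g := M.left.act_of_eq_one rfl h
  have h1 := M.right_mul (Arr.one H A) (Arr.one H A) g rfl h
  have hc : (M.right.act (Arr.one H A) g h).tgt = (M.right.act (Arr.one H A) g h).src :=
    (M.right.q_act _ _ _).trans ((congrArg Arr.tgt h0).symm.trans (M.corner _ _ _))
  have h2 : M.right.act (Arr.one H A) g h =
      (M.right.act (Arr.one H A) g h).mul (M.right.act (Arr.one H A) g h) hc :=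
    (M.right.congr (Arr.one_mul (Arr.one H A) rfl).symm rfl h).trans
      (h1.trans (Arr.mul_congr (M.right.congr rfl h0 _) rfl _))
  exact (Arr.eq_one_of_mul_self _ _ h2.symm).trans
    (congrArg (Arr.one H) (hc.symm.trans (M.right.q_act _ _ _)))

/-- The dual (transpose) matched pair `(H, V)`: `f ⇀ y = (y⁻¹ ◁ f⁻¹)⁻¹` and
`f ↼ y = (y⁻¹ ▷ f⁻¹)⁻¹`, for `f` in `V` and `y` in `H` with `f.tgt = y.src`. -/
def dual {P : Type u} {V H : Groupoid.{u} P} (M : MatchedPair V H) : MatchedPair H V where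
  left :=
    { act := fun f y h => (M.right.act y.inv f.inv h.symm).inv
      p_act := fun f y h => M.right.q_act y.inv f.inv h.symm
      act_act := fun g k y hgk h => congrArg Arr.inv
        ((M.right.congr (Arr.inv_inv _) rfl _).trans
          ((M.right.act_act y.inv k.inv g.inv h.symm hgk.symm).trans
            (M.right.congr rfl (Arr.mul_inv_rev g k hgk).symm _)))
      one_act := fun y => (congrArg Arr.inv
        ((M.right.congr rfl (Arr.inv_one V y.src) _).trans (M.right_one y.inv rfl))).trans
          y.inv_inv }
  right :=
    { act := fun f y h => (M.left.act y.inv f.inv h.symm).inv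
      q_act := fun f y h => M.left.p_act y.inv f.inv h.symm
      act_act := fun f y z h hyz => congrArg Arr.inv
        ((M.left.congr rfl (Arr.inv_inv _) _).trans
          ((M.left.act_act z.inv y.inv f.inv hyz.symm h.symm).trans
            (M.left.congr (Arr.mul_inv_rev y z hyz).symm rfl _)))
      act_one := fun f => (congrArg Arr.inv
        (M.left.act_of_eq_one (Arr.inv_one H f.tgt) _)).trans f.inv_inv }
  corner f y h := (M.corner y.inv f.inv h.symm).symm
  left_mul f y z h hyz :=
    (congrArg Arr.inv ((M.right.congr (Arr.mul_inv_rev y z hyz) rfl _).trans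
      (M.right_mul z.inv y.inv f.inv hyz.symm h.symm))).trans
      ((Arr.mul_inv_rev _ _ _).trans
        (Arr.mul_congr rfl (congrArg Arr.inv (M.right.congr rfl (Arr.inv_inv _).symm _)) _))
  right_mul f g y hfg h :=
    (congrArg Arr.inv ((M.left.congr rfl (Arr.mul_inv_rev f g hfg) _).trans
      (M.left_mul y.inv g.inv f.inv h.symm hfg.symm))).trans
      ((Arr.mul_inv_rev _ _ _).trans
        (Arr.mul_congr (congrArg Arr.inv (M.left.congr (Arr.inv_inv _).symm rfl _)) rfl _))

end MatchedPair

/-! ### Representations of a matched pair -/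

/-- A representation of the matched pair `(V, H)`: a quiver over `P` with a left action of `H` on
`p` and a grading `deg` over `V` (the decomposition into the fibres of `deg`), compatible with the
quiver maps and with the action of `H` on `V`. -/
structure Rep {P : Type u} {V H : Groupoid.{u} P} (M : MatchedPair V H) : Type (u + 1)
    extends QuivOver P where
  action : LeftAction H p
  deg : carrier → Arr V
  p_eq : ∀ e, p e = (deg e).src
  q_eq : ∀ e, q e = (deg e).tgt
  deg_act : ∀ (x : Arr H) (e : carrier) (h : x.tgt = p e),
    deg (action.act x e h) = M.left.act x (deg e) (h.trans (p_eq e))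

namespace Rep

section

variable {P : Type u} {V H : Groupoid.{u} P} {M : MatchedPair V H}

/-- A morphism of representations: a map of quivers which intertwines the actions of `H` and
preserves the gradings. -/
@[ext]
structure Hom (E F : Rep M) where
  hom : E.toQuivOver ⟶ F.toQuivOver
  map_act : ∀ (x : Arr H) (e : E.carrier) (h : x.tgt = E.p e),
    hom.toFun (E.action.act x e h) =
      F.action.act x (hom.toFun e) (h.trans (hom.p_comm e).symm)
  map_deg : ∀ e : E.carrier, F.deg (hom.toFun e) = E.deg e

instance : Category (Rep M) where
  Hom := Hom
  id E := { hom := 𝟙 E.toQuivOver, map_act := fun _ _ _ => rfl, map_deg := fun _ => rfl }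
  comp f g :=
    { hom := f.hom ≫ g.hom
      map_act := fun x e h => by
        simp only [QuivOver.comp_toFun, f.map_act, g.map_act]
      map_deg := fun e => (g.map_deg _).trans (f.map_deg e) }

@[ext]
theorem hom_ext {E F : Rep M} (f g : E ⟶ F) (h : f.hom = g.hom) : f = g := Hom.ext h

@[simp]
theorem id_hom (E : Rep M) : Hom.hom (𝟙 E) = 𝟙 E.toQuivOver := rfl

@[simp]
theorem comp_hom {E F K : Rep M} (f : E ⟶ F) (g : F ⟶ K) : (f ≫ g).hom = f.hom ≫ g.hom := rfl

/-- An isomorphism of quivers which is a morphism of representations is an isomorphism of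
representations. -/
def isoMk {E F : Rep M} (i : E.toQuivOver ≅ F.toQuivOver)
    (map_act : ∀ (x : Arr H) (e : E.carrier) (h : x.tgt = E.p e),
      i.hom.toFun (E.action.act x e h) =
        F.action.act x (i.hom.toFun e) (h.trans (i.hom.p_comm e).symm))
    (map_deg : ∀ e : E.carrier, F.deg (i.hom.toFun e) = E.deg e) : E ≅ F where
  hom := { hom := i.hom, map_act := map_act, map_deg := map_deg }
  inv :=
    { hom := i.inv
      map_act := fun x f h => by
        have hr : ∀ y, i.hom.toFun (i.inv.toFun y) = y := fun y =>
          congrFun (congrArg QuivOver.Hom.toFun i.inv_hom_id) y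
        have hl : ∀ y, i.inv.toFun (i.hom.toFun y) = y := fun y =>
          congrFun (congrArg QuivOver.Hom.toFun i.hom_inv_id) y
        have h1 := map_act x (i.inv.toFun f) (h.trans (i.inv.p_comm f).symm)
        simp only [hr] at h1
        rw [← h1, hl]
      map_deg := fun f => by
        have hr : i.hom.toFun (i.inv.toFun f) = f :=
          congrFun (congrArg QuivOver.Hom.toFun i.inv_hom_id) f
        rw [← map_deg, hr] }
  hom_inv_id := hom_ext _ _ i.hom_inv_id
  inv_hom_id := hom_ext _ _ i.inv_hom_id

/-- The tensor product of representations: on the tensor product of the quivers, the action is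
`x ▷ (e, f) = (x ▷ e, (x ◁ |e|) ▷ f)` and the grading is `|(e, f)| = |e| |f|`. -/
def tensorObj (E F : Rep M) : Rep M where
  toQuivOver := E.toQuivOver ⊗ F.toQuivOver
  action :=
    { act := fun x z h =>
        ⟨(E.action.act x z.1.1 h,
          F.action.act (M.right.act x (E.deg z.1.1) (h.trans (E.p_eq _))) z.1.2
            ((M.right.q_act _ _ _).trans ((E.q_eq _).symm.trans z.2))),
          (E.q_eq _).trans ((congrArg Arr.tgt (E.deg_act _ _ _)).trans
            ((M.corner _ _ _).trans (F.action.p_act _ _ _).symm))⟩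
      p_act := fun x z h => E.action.p_act x z.1.1 h
      act_act := fun x y z hxy h => Subtype.ext (Prod.ext (E.action.act_act x y z.1.1 hxy h)
        ((F.action.congr (M.right.congr rfl (E.deg_act _ _ _) _) rfl _).trans
          ((F.action.act_act _ _ _ _ _).trans
            (F.action.congr (M.right_mul x y (E.deg z.1.1) hxy _).symm rfl _))))
      one_act := fun z => Subtype.ext (Prod.ext (E.action.one_act z.1.1)
        (F.action.act_of_eq_one (M.one_right _ _) _)) }
  deg z := (E.deg z.1.1).mul (F.deg z.1.2) ((E.q_eq _).symm.trans (z.2.trans (F.p_eq _)))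
  p_eq z := E.p_eq z.1.1
  q_eq z := F.q_eq z.1.2
  deg_act x z h :=
    (Arr.mul_congr (E.deg_act x z.1.1 h) (F.deg_act _ _ _) _).trans
      (M.left_mul x (E.deg z.1.1) (F.deg z.1.2) _ _).symm

/-- The unit representation `P`: the action is `x ▷ x.tgt = x.src`, and `A` has degree the
identity of `V` at `A`. -/
def tensorUnit (M : MatchedPair V H) : Rep M where
  toQuivOver := 𝟙_ (QuivOver P)
  action :=
    { act := fun x _ _ => x.src
      p_act := fun _ _ _ => rfl
      act_act := fun _ _ _ _ _ => rfl
      one_act := fun _ => rfl }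
  deg A := Arr.one V A
  p_eq _ := rfl
  q_eq _ := rfl
  deg_act x _ h := (M.left_one x h).symm

/-- The tensor product of morphisms is that of the underlying maps of quivers. -/
def tensorHom {E E' F F' : Rep M} (f : E ⟶ E') (g : F ⟶ F') :
    tensorObj E F ⟶ tensorObj E' F' where
  hom := f.hom ⊗ₘ g.hom
  map_act x z h := Subtype.ext (Prod.ext (f.map_act x z.1.1 h)
    ((g.map_act _ _ _).trans
      (F'.action.congr (M.right.congr rfl (f.map_deg z.1.1).symm _) rfl _)))
  map_deg z := Arr.mul_congr (f.map_deg z.1.1) (g.map_deg z.1.2) _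

instance : MonoidalCategoryStruct (Rep M) where
  tensorObj := tensorObj
  tensorHom := tensorHom
  whiskerLeft E _ _ f := tensorHom (𝟙 E) f
  whiskerRight f E := tensorHom f (𝟙 E)
  tensorUnit := tensorUnit M
  associator E F K := isoMk (α_ E.toQuivOver F.toQuivOver K.toQuivOver)
    (fun x z _ => Subtype.ext (Prod.ext rfl (Subtype.ext (Prod.ext rfl
      (K.action.congr (M.right.act_act x (E.deg z.1.1.1.1) (F.deg z.1.1.1.2) _ _).symm rfl _)))))
    (fun _ => (Arr.mul_assoc _ _ _ _ _).symm)
  leftUnitor E := isoMk (λ_ E.toQuivOver)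
    (fun x _ h => E.action.congr (M.right_one x h) rfl _)
    (fun _ => (Arr.one_mul _ _).symm)
  rightUnitor E := isoMk (ρ_ E.toQuivOver)
    (fun _ _ _ => rfl)
    (fun _ => (Arr.mul_one _ _).symm)

instance : MonoidalCategory (Rep M) where
  tensorHom_def _ _ := rfl
  id_tensorHom_id _ _ := rfl
  tensorHom_comp_tensorHom _ _ _ _ := rfl
  whiskerLeft_id _ _ := rfl
  id_whiskerRight _ _ := rfl
  associator_naturality _ _ _ := rfl
  leftUnitor_naturality _ := rfl
  rightUnitor_naturality _ := rfl
  pentagon _ _ _ _ := rfl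
  triangle _ _ := rfl

/-- The forgetful functor to quivers, which forgets the action and the grading. -/
def forget (M : MatchedPair V H) : Rep M ⥤ QuivOver P where
  obj E := E.toQuivOver
  map f := f.hom

/-- The forgetful functor is monoidal, its structural isomorphisms being identities. -/
def forgetCoreMonoidal (M : MatchedPair V H) : (forget M).CoreMonoidal where
  εIso := Iso.refl _
  μIso E F := Iso.refl (E.toQuivOver ⊗ F.toQuivOver)
  μIso_hom_natural_left _ _ := rfl
  μIso_hom_natural_right _ _ := rfl
  associativity _ _ _ := rfl
  left_unitality _ := rfl
  right_unitality _ := rfl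

instance (M : MatchedPair V H) : (forget M).Monoidal := (forgetCoreMonoidal M).toMonoidal

end

end Rep

end MatchedPairs

/-!
A representation `D` of the dual pair `(H, V)` crosses every representation `E` of `(V, H)` by
`(e, d) ↦ (|e| ▷ d, ||e| ▷ d|⁻¹ ▷ e)`. The identity `|g ▷ d|⁻¹ ◁ g = |d|⁻¹` (`deg_inv_right_deg`),
a reformulation of the compatibility of the grading of `D` with the dual action, makes this
a bijection `E ⊗ D → D ⊗ E` of quivers, natural in both variables, and turns tensor products in
either variable into composites of crossings. Hence `D` gives an object `ofRep D` of the
centralizer, on the same quiver.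

Conversely, an object `(D, ζ)` of the centralizer is determined by `ζ` on two kinds of
representations.
* The arrows of `V` form the terminal representation (`arrows`), to which every `E` maps by its
  grading. By naturality the first component of `ζ (e, d)` depends only on `|e|` and `d`, and
  it defines an action of `V` on `D`.
* On the arrows of `H` ending at a point `B` (`translations`), with `H` acting by translations and
  all degrees identities, `ζ` carries the pair of the identity at `B = p d` and `d` to a pair
  consisting of `d` and an arrow of `H`, which is taken as `|d|⁻¹`.

The second component of `ζ (e, d)` is then forced (`cross_snd`): the points `(x, x ▷ e)` form
a subrepresentation of `translations M (p e) ⊗ E` (`freeGraph`), so `ζ` on this tensor product,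
computed from its two factors, carries `(1, e)` to a pair of the form `(x, x ▷ e)`, and here `x` is
the inverse degree of the point which `e` has produced. Applying this formula to a point of
`arrows M ⊗ translations M B` gives the compatibility of the grading with the action
(`invDeg_eq`).

Both constructions keep the underlying quivers and maps, and all units, counits and monoidal
structure maps lie over identities. An object of either category is determined by its quiver
together with the knowledge that the identity map is a morphism (`eq_of_hom`), which makes the
monoidal functors strict.
-/

/-! ### Morphisms of the centralizer over identities -/

namespace CategoryTheory.Centralizer

open MonoidalCategory

universe v₁ v₂ u₁ u₂

variable {C : Type u₁} [Category.{v₁} C] [MonoidalCategory C]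
  {D : Type u₂} [Category.{v₂} D] [MonoidalCategory D] {F : C ⥤ D} [F.Monoidal]

/-- Objects of the centralizer joined by a morphism lying over an identity are equal. -/
theorem eq_of_hom {A B : Centralizer F} (h : A.obj = B.obj) (f : A ⟶ B)
    (hf : f.hom = eqToHom h) : A = B := by
  obtain ⟨A, ζ, _, _, _⟩ := A
  obtain ⟨B, ζ', _, _, _⟩ := B
  dsimp at h
  subst h
  have hζ : ζ = ζ' := funext fun X => Iso.ext (by
    have hc := f.comm X
    rw [hf] at hc
    simpa using hc.symm)
  subst hζ
  rfl

/-- A morphism of the centralizer lying over an identity is an identity. -/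
theorem hom_eq_eqToHom {A B : Centralizer F} (h : A = B) (f : A ⟶ B)
    (hf : f.hom = eqToHom (congrArg obj h)) : f = eqToHom h := by
  subst h
  exact hom_ext _ _ hf

end CategoryTheory.Centralizer

namespace MatchedPairs

open CategoryTheory MonoidalCategory

variable {P : Type u} {V H : Groupoid.{u} P}

/-! ### Inverses in actions and matched pairs -/

namespace LeftAction

variable {G : Groupoid.{u} P} {E : Type u} {p : E → P}

theorem inv_act_act (a : LeftAction G p) (g : Arr G) (e : E) (h : g.tgt = p e) :
    a.act g.inv (a.act g e h) (a.p_act g e h).symm = e :=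
  (a.act_act g.inv g e rfl h).trans (a.act_of_eq_one g.inv_mul h)

theorem act_inv_act (a : LeftAction G p) (g : Arr G) (e : E) (h : g.src = p e) :
    a.act g (a.act g.inv e h) (a.p_act g.inv e h).symm = e :=
  (a.act_act g g.inv e rfl h).trans (a.act_of_eq_one g.mul_inv h)

end LeftAction

theorem Arr.eq_inv_of_mul_eq_one {G : Groupoid.{u} P} (x y : Arr G) (h : x.tgt = y.src)
    (hxy : x.mul y h = Arr.one G x.src) : y = x.inv :=
  (Arr.one_mul y h).symm.trans ((Arr.mul_congr x.inv_mul.symm rfl h).trans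
    ((Arr.mul_assoc x.inv x y rfl h).trans
      ((Arr.mul_congr rfl hxy _).trans (Arr.mul_one x.inv rfl))))

namespace MatchedPair

variable (M : MatchedPair V H)

theorem right_inv_right (x : Arr H) (g : Arr V) (h : x.tgt = g.tgt) :
    M.right.act (M.right.act x g.inv h) g (M.right.q_act x g.inv h) = x :=
  (M.right.act_act x g.inv g h rfl).trans
    ((M.right.congr rfl g.inv_mul _).trans (M.right_one x h))

/-- The inverse of `x ▷ g⁻¹` is `(x ◁ g⁻¹) ▷ g`. -/
theorem left_right_inv (x : Arr H) (g : Arr V) (h : x.tgt = g.tgt) :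
    M.left.act (M.right.act x g.inv h) g (M.right.q_act x g.inv h) =
      (M.left.act x g.inv h).inv := by
  refine Arr.eq_inv_of_mul_eq_one _ _ ((M.corner x g.inv h).trans (M.left.p_act _ _ _).symm)
    ((M.left_mul x g.inv g h rfl).symm.trans ?_)
  exact (M.left.congr rfl g.inv_mul h).trans ((M.left_one x h).trans
    (congrArg (Arr.one V) (M.left.p_act _ _ _).symm))

end MatchedPair

/-! ### Crossings of representations of a matched pair and of its dual -/

namespace Rep

variable {M : MatchedPair V H}

/-- Representations joined by a morphism lying over an identity are equal. -/
theorem eq_of_hom {E F : Rep M} (h : E.toQuivOver = F.toQuivOver) (f : E ⟶ F)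
    (hf : f.hom = eqToHom h) : E = F := by
  obtain ⟨E, ⟨a, _, _, _⟩, d, _, _, _⟩ := E
  obtain ⟨F, ⟨a', _, _, _⟩, d', _, _, _⟩ := F
  dsimp at h
  subst h
  obtain ⟨f, h1, h2⟩ := f
  obtain rfl : f = 𝟙 _ := hf
  obtain rfl : a = a' := funext fun x => funext fun e => funext fun h => h1 x e h
  obtain rfl : d' = d := funext fun e => h2 e
  rfl

/-- A morphism of representations lying over an identity is an identity. -/
theorem hom_eq_eqToHom {E F : Rep M} (h : E = F) (f : E ⟶ F)
    (hf : f.hom = eqToHom (congrArg toQuivOver h)) : f = eqToHom h := by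
  subst h
  exact hom_ext _ _ hf

/-- The identity `|g ▷ d|⁻¹ ◁ g = |d|⁻¹`, where `|g ▷ d|⁻¹ = |d|⁻¹ ◁ g⁻¹` by the definition of the
dual pair. -/
theorem deg_inv_right_deg (D : Rep M.dual) (g : Arr V) (d : D.carrier) (h : g.tgt = D.p d) :
    M.right.act (D.deg (D.action.act g d h)).inv g
      ((D.p_eq _).symm.trans (D.action.p_act g d h)) = (D.deg d).inv :=
  (M.right.congr ((congrArg Arr.inv (D.deg_act g d h)).trans (Arr.inv_inv _)) rfl _).trans
    (M.right_inv_right (D.deg d).inv g (h.trans (D.p_eq d)).symm)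

/-- The arrow of `V` which remains after `g` has acted on `d`: the right action `g ↼ |d|` of the
dual pair is `|g ▷ d|⁻¹ ▷ g`. -/
theorem deg_inv_left_deg (D : Rep M.dual) (g : Arr V) (d : D.carrier) (h : g.tgt = D.p d) :
    M.left.act (D.deg (D.action.act g d h)).inv g
      ((D.p_eq _).symm.trans (D.action.p_act g d h)) =
        M.dual.right.act g (D.deg d) (h.trans (D.p_eq d)) :=
  (M.left.congr ((congrArg Arr.inv (D.deg_act g d h)).trans (Arr.inv_inv _)) rfl _).trans
    (M.left_right_inv (D.deg d).inv g (h.trans (D.p_eq d)).symm)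

/-- The crossing of a representation `E` with a representation `D` of the dual
matched pair: `(e, d) ↦ (|e| ▷ d, ||e| ▷ d|⁻¹ ▷ e)`. -/
def crossing (E : Rep M) (D : Rep M.dual) :
    E.toQuivOver ⊗ D.toQuivOver ⟶ D.toQuivOver ⊗ E.toQuivOver where
  toFun z :=
    have h : (E.deg z.1.1).tgt = D.p z.1.2 := (E.q_eq _).symm.trans z.2
    have h' : (D.deg (D.action.act (E.deg z.1.1) z.1.2 h)).src = E.p z.1.1 :=
      (D.p_eq _).symm.trans ((D.action.p_act _ _ _).trans (E.p_eq _).symm)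
    ⟨(D.action.act (E.deg z.1.1) z.1.2 h,
      E.action.act (D.deg (D.action.act (E.deg z.1.1) z.1.2 h)).inv z.1.1 h'),
      (D.q_eq _).trans (E.action.p_act
        (D.deg (D.action.act (E.deg z.1.1) z.1.2 h)).inv z.1.1 h').symm⟩
  p_comm z := (D.action.p_act _ _ _).trans (E.p_eq _).symm
  q_comm z := by
    refine (E.q_eq _).trans ((congrArg Arr.tgt (E.deg_act _ _ _)).trans ((M.corner _ _ _).trans
      ((congrArg Arr.src (deg_inv_right_deg D _ _ ((E.q_eq _).symm.trans z.2))).trans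
        (D.q_eq _).symm)))

/-- The crossing is bijective: its inverse sends `(d, e)` to `(|d| ▷ e, ||d| ▷ e|⁻¹ ▷ d)`. -/
def crossingIso (E : Rep M) (D : Rep M.dual) :
    E.toQuivOver ⊗ D.toQuivOver ≅ D.toQuivOver ⊗ E.toQuivOver :=
  have hE (w : (D.toQuivOver ⊗ E.toQuivOver).carrier) : (D.deg w.1.1).tgt = E.p w.1.2 :=
    (D.q_eq _).symm.trans w.2
  have hD (w : (D.toQuivOver ⊗ E.toQuivOver).carrier) :
      (E.deg (E.action.act (D.deg w.1.1) w.1.2 (hE w))).src = D.p w.1.1 :=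
    (E.p_eq _).symm.trans ((E.action.p_act _ _ _).trans (D.p_eq _).symm)
  let inv (w : (D.toQuivOver ⊗ E.toQuivOver).carrier) : (E.toQuivOver ⊗ D.toQuivOver).carrier :=
    ⟨(E.action.act (D.deg w.1.1) w.1.2 (hE w),
      D.action.act (E.deg (E.action.act (D.deg w.1.1) w.1.2 (hE w))).inv w.1.1 (hD w)),
      (E.q_eq _).trans (D.action.p_act
        (E.deg (E.action.act (D.deg w.1.1) w.1.2 (hE w))).inv w.1.1 (hD w)).symm⟩
  have hr (w) : (crossing E D).toFun (inv w) = w := by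
    have h1 := D.action.act_inv_act _ _ (hD w)
    refine Subtype.ext (Prod.ext h1 ?_)
    exact (E.action.congr (congrArg (fun d => (D.deg d).inv) h1) rfl _).trans
      (E.action.inv_act_act _ _ (hE w))
  have hl (z) : inv ((crossing E D).toFun z) = z := by
    have h : (E.deg z.1.1).tgt = D.p z.1.2 := (E.q_eq _).symm.trans z.2
    have h1 := E.action.act_inv_act (D.deg (D.action.act (E.deg z.1.1) z.1.2 h)) z.1.1
      ((D.p_eq _).symm.trans ((D.action.p_act _ _ _).trans (E.p_eq _).symm))
    refine Subtype.ext (Prod.ext h1 ?_)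
    exact (D.action.congr (congrArg (fun e => (E.deg e).inv) h1) rfl _).trans
      (D.action.inv_act_act _ _ h)
  { hom := crossing E D
    inv :=
      { toFun := inv
        p_comm := fun w => ((crossing E D).p_comm (inv w)).symm.trans
          (congrArg (D.toQuivOver ⊗ E.toQuivOver).p (hr w))
        q_comm := fun w => ((crossing E D).q_comm (inv w)).symm.trans
          (congrArg (D.toQuivOver ⊗ E.toQuivOver).q (hr w)) }
    hom_inv_id := QuivOver.hom_ext _ _ hl
    inv_hom_id := QuivOver.hom_ext _ _ hr }

/-- Two pairs in a tensor product of quivers are equal if their components are. -/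
theorem tensor_ext {X Y : QuivOver P} {z w : (X ⊗ Y).carrier} (h1 : z.1.1 = w.1.1)
    (h2 : z.1.2 = w.1.2) : z = w := Subtype.ext (Prod.ext h1 h2)

theorem crossing_naturality_left {E F : Rep M} (f : E ⟶ F) (D : Rep M.dual) :
    f.hom ▷ D.toQuivOver ≫ crossing F D = crossing E D ≫ D.toQuivOver ◁ f.hom := by
  refine QuivOver.hom_ext _ _ fun z => ?_
  have h1 := D.action.congr (f.map_deg z.1.1) (Eq.refl z.1.2)
    ((F.q_eq _).symm.trans ((f.hom.q_comm _).trans z.2))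
  exact tensor_ext h1 ((F.action.congr (congrArg (fun d => (D.deg d).inv) h1) rfl _).trans
    (f.map_act _ _ _).symm)

theorem crossing_naturality_right (E : Rep M) {D D' : Rep M.dual} (f : D ⟶ D') :
    E.toQuivOver ◁ f.hom ≫ crossing E D' = crossing E D ≫ f.hom ▷ E.toQuivOver := by
  refine QuivOver.hom_ext _ _ fun z => ?_
  have h1 := (f.map_act (E.deg z.1.1) z.1.2 ((E.q_eq _).symm.trans z.2)).symm
  exact tensor_ext h1 (E.action.congr (congrArg Arr.inv
    ((congrArg D'.deg h1).trans (f.map_deg _))) rfl _)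

theorem crossing_tensor_left (E F : Rep M) (D : Rep M.dual) :
    crossing (E ⊗ F) D = (α_ E.toQuivOver F.toQuivOver D.toQuivOver).hom ≫
      E.toQuivOver ◁ crossing F D ≫ (α_ E.toQuivOver D.toQuivOver F.toQuivOver).inv ≫
        crossing E D ▷ F.toQuivOver ≫ (α_ D.toQuivOver E.toQuivOver F.toQuivOver).hom := by
  refine QuivOver.hom_ext _ _ fun z => ?_
  have hF : (F.deg z.1.1.1.2).tgt = D.p z.1.2 := (F.q_eq _).symm.trans z.2
  have hE : (E.deg z.1.1.1.1).tgt = (F.deg z.1.1.1.2).src :=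
    (E.q_eq _).symm.trans (z.1.1.2.trans (F.p_eq _))
  have h1 := (D.action.act_act (E.deg z.1.1.1.1) (F.deg z.1.1.1.2) z.1.2 hE hF).symm
  have h2 := congrArg (fun d => (D.deg d).inv) h1
  refine tensor_ext h1 (tensor_ext (E.action.congr h2 rfl _) ?_)
  exact F.action.congr ((M.right.congr h2 rfl _).trans (deg_inv_right_deg D _ _ _)) rfl _

theorem crossing_unit_left (D : Rep M.dual) :
    crossing (𝟙_ (Rep M)) D = (λ_ D.toQuivOver).hom ≫ (ρ_ D.toQuivOver).inv := by
  refine QuivOver.hom_ext _ _ fun z => ?_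
  have h1 : D.action.act (Arr.one V z.1.1) z.1.2 z.2 = z.1.2 := D.action.act_of_eq_one rfl z.2
  exact tensor_ext h1 ((D.q_eq _).symm.trans (congrArg D.q h1))

theorem crossing_tensor_right (E : Rep M) (D D' : Rep M.dual) :
    crossing E (D ⊗ D') = (α_ E.toQuivOver D.toQuivOver D'.toQuivOver).inv ≫
      crossing E D ▷ D'.toQuivOver ≫ (α_ D.toQuivOver E.toQuivOver D'.toQuivOver).hom ≫
        D.toQuivOver ◁ crossing E D' ≫ (α_ D.toQuivOver D'.toQuivOver E.toQuivOver).inv := by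
  refine QuivOver.hom_ext _ _ fun z => ?_
  have h : (E.deg z.1.1).tgt = D.p z.1.2.1.1 := (E.q_eq _).symm.trans z.2
  have h' : (D.deg (D.action.act (E.deg z.1.1) z.1.2.1.1 h)).src = E.p z.1.1 :=
    (D.p_eq _).symm.trans ((D.action.p_act _ _ _).trans (E.p_eq _).symm)
  have h1 := D'.action.congr ((deg_inv_left_deg D _ _ h).symm.trans (E.deg_act _ _ h').symm)
    (Eq.refl z.1.2.1.2) ((M.dual.right.q_act _ _ _).trans ((D.q_eq _).symm.trans z.1.2.2))
  refine tensor_ext (tensor_ext rfl h1) ?_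
  refine (E.action.congr (Arr.mul_inv_rev _ _ _) rfl _).trans
    ((E.action.act_act _ _ _ _ _).symm.trans ?_)
  exact E.action.congr (congrArg (fun d => (D'.deg d).inv) h1) rfl _

theorem crossing_unit_right (E : Rep M) :
    crossing E (𝟙_ (Rep M.dual)) = (ρ_ E.toQuivOver).hom ≫ (λ_ E.toQuivOver).inv := by
  refine QuivOver.hom_ext _ _ fun z => ?_
  exact tensor_ext (E.p_eq _).symm (E.action.act_of_eq_one (Arr.inv_one H _) _)

/-! ### Test representations -/

/-- The arrows of `V`, graded by themselves: the terminal representation. -/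
def arrows (M : MatchedPair V H) : Rep M where
  carrier := Arr V
  p := Arr.src
  q := Arr.tgt
  action := M.left
  deg g := g
  p_eq _ := rfl
  q_eq _ := rfl
  deg_act _ _ _ := rfl

/-- The grading of a representation, as a morphism to the terminal representation. -/
def degHom (E : Rep M) : E ⟶ arrows M where
  hom := { toFun := E.deg, p_comm := fun e => (E.p_eq e).symm, q_comm := fun e => (E.q_eq e).symm }
  map_act := E.deg_act
  map_deg _ := rfl

/-- The representation freely generated by a point of the same degree as `e`. The arrow `x`
of `H` ending at `p e` stands for the point obtained by letting `x` act on the generator. -/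
def free (E : Rep M) (e : E.carrier) : Rep M where
  carrier := {x : Arr H // x.tgt = E.p e}
  p x := x.1.src
  q x := E.q (E.action.act x.1 e x.2)
  action :=
    { act := fun y x h => ⟨y.mul x.1 h, x.2⟩
      p_act := fun _ _ _ => rfl
      act_act := fun y z x hyz h => Subtype.ext (Arr.mul_assoc y z x.1 hyz h).symm
      one_act := fun x => Subtype.ext (Arr.one_mul x.1 rfl) }
  deg x := E.deg (E.action.act x.1 e x.2)
  p_eq x := (E.action.p_act x.1 e x.2).symm.trans (E.p_eq _)
  q_eq _ := E.q_eq _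
  deg_act y x h := (congrArg E.deg (E.action.act_act y x.1 e h x.2).symm).trans (E.deg_act _ _ _)

/-- The generator of `free E e`. -/
def freeGen (E : Rep M) (e : E.carrier) : (free E e).carrier := ⟨Arr.one H (E.p e), rfl⟩

/-- The morphism from `free E e` to `E` which carries the generator to `e`. -/
def freeEval (E : Rep M) (e : E.carrier) : free E e ⟶ E where
  hom :=
    { toFun := fun x => E.action.act x.1 e x.2
      p_comm := fun x => E.action.p_act x.1 e x.2
      q_comm := fun _ => rfl }
  map_act y x h := (E.action.act_act y x.1 e h x.2).symm
  map_deg _ := rfl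

/-- The representation of `H` by left translations on its arrows ending at `B`. All degrees are
identities. -/
def translations (M : MatchedPair V H) (B : P) : Rep M := free (𝟙_ (Rep M)) B

/-- The morphism `x ↦ (x, x ▷ e)`. The points `(x, f)` with `x⁻¹ ▷ f = e` are those in its
image. -/
def freeGraph (E : Rep M) (e : E.carrier) : free E e ⟶ translations M (E.p e) ⊗ E where
  hom :=
    { toFun := fun x => ⟨(⟨x.1, x.2⟩, E.action.act x.1 e x.2), (E.action.p_act x.1 e x.2).symm⟩
      p_comm := fun _ => rfl
      q_comm := fun _ => rfl }
  map_act y x h := tensor_ext rfl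
    ((E.action.act_act y x.1 e h x.2).symm.trans (E.action.congr (M.right_one y h).symm rfl _))
  map_deg _ := Arr.one_mul _ _

end Rep

open MatchedPairs.Rep

/-! ### The representation carried by an object of the centralizer -/

section Reconstruction

variable {M : MatchedPair V H} (A : Centralizer (Rep.forget M))

/-- The value of `ζ` of an object of the centralizer at a composable pair `(e, d)`. -/
def cross (E : Rep M) (e : E.carrier) (d : A.obj.carrier) (h : E.q e = A.obj.p d) :
    (A.obj ⊗ E.toQuivOver).carrier :=
  (A.ζ E).hom.toFun ⟨(e, d), h⟩

theorem cross_congr {E : Rep M} {e e' : E.carrier} {d d' : A.obj.carrier} (he : e = e')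
    (hd : d = d') (h : E.q e = A.obj.p d) :
    cross A E e d h = cross A E e' d' (he ▸ hd ▸ h) := by
  subst he hd; rfl

theorem p_cross {E : Rep M} (e : E.carrier) (d : A.obj.carrier) (h : E.q e = A.obj.p d) :
    A.obj.p (cross A E e d h).1.1 = E.p e :=
  (A.ζ E).hom.p_comm ⟨(e, d), h⟩

theorem q_cross {E : Rep M} (e : E.carrier) (d : A.obj.carrier) (h : E.q e = A.obj.p d) :
    E.q (cross A E e d h).1.2 = A.obj.q d :=
  (A.ζ E).hom.q_comm ⟨(e, d), h⟩

theorem cross_map {E F : Rep M} (f : E ⟶ F) (e : E.carrier) (d : A.obj.carrier)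
    (h : E.q e = A.obj.p d) :
    cross A F (f.hom.toFun e) d ((f.hom.q_comm e).trans h) =
      ⟨((cross A E e d h).1.1, f.hom.toFun (cross A E e d h).1.2),
        (cross A E e d h).2.trans (f.hom.p_comm _).symm⟩ :=
  congrFun (congrArg QuivOver.Hom.toFun (A.naturality f)) ⟨(e, d), h⟩

theorem cross_tensor {E F : Rep M} (e : E.carrier) (f : F.carrier) (hef : E.q e = F.p f)
    (d : A.obj.carrier) (h : F.q f = A.obj.p d) :
    cross A (E ⊗ F) ⟨(e, f), hef⟩ d h =
      have h' := hef.trans (p_cross A f d h).symm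
      ⟨((cross A E e (cross A F f d h).1.1 h').1.1,
        ⟨((cross A E e (cross A F f d h).1.1 h').1.2, (cross A F f d h).1.2),
          (q_cross A e _ h').trans (cross A F f d h).2⟩),
        (cross A E e (cross A F f d h).1.1 h').2⟩ :=
  congrFun (congrArg QuivOver.Hom.toFun (A.tensor E F)) ⟨(⟨(e, f), hef⟩, d), h⟩

theorem cross_unit (B : P) (d : A.obj.carrier) (h : B = A.obj.p d) :
    cross A (𝟙_ (Rep M)) B d h = ⟨(d, A.obj.q d), rfl⟩ :=
  congrFun (congrArg QuivOver.Hom.toFun A.unit) ⟨(B, d), h⟩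

/-- The action of `V` on the quiver underlying an object of the centralizer. -/
def actOn (g : Arr V) (d : A.obj.carrier) (h : g.tgt = A.obj.p d) : A.obj.carrier :=
  (cross A (arrows M) g d h).1.1

/-- The first component of `ζ (e, d)` depends only on `|e|` and `d`, because `V` is terminal. -/
theorem cross_fst {E : Rep M} (e : E.carrier) (d : A.obj.carrier) (h : E.q e = A.obj.p d) :
    (cross A E e d h).1.1 = actOn A (E.deg e) d ((E.q_eq e).symm.trans h) :=
  (congrArg (fun w => w.1.1) (cross_map A (degHom E) e d h)).symm

/-- The inverse of the degree of a point `d` starting at `B`: the translate to which `ζ` carries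
the generator of `translations M B` when it crosses `d`. -/
def invDeg (B : P) (d : A.obj.carrier) (h : B = A.obj.p d) : Arr H :=
  (cross A (translations M B) (freeGen (𝟙_ (Rep M)) B) d h).1.2.1

theorem invDeg_congr {B B' : P} {d d' : A.obj.carrier} (hB : B = B') (hd : d = d')
    (h : B = A.obj.p d) : invDeg A B d h = invDeg A B' d' (hB ▸ hd ▸ h) := by
  subst hB hd; rfl

theorem tgt_invDeg (B : P) (d : A.obj.carrier) (h : B = A.obj.p d) :
    (invDeg A B d h).tgt = B :=
  (cross A (translations M B) (freeGen (𝟙_ (Rep M)) B) d h).1.2.2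

theorem cross_translations_fst (B : P) (d : A.obj.carrier) (h : B = A.obj.p d) :
    (cross A (translations M B) (freeGen (𝟙_ (Rep M)) B) d h).1.1 = d :=
  (congrArg (fun w => w.1.1) (cross_map A (freeEval (𝟙_ (Rep M)) B)
    (freeGen (𝟙_ (Rep M)) B) d h)).symm.trans
    (congrArg (fun w => w.1.1) (cross_unit A B d h))

theorem src_invDeg (B : P) (d : A.obj.carrier) (h : B = A.obj.p d) :
    (invDeg A B d h).src = A.obj.q d :=
  (cross A (translations M B) (freeGen (𝟙_ (Rep M)) B) d h).2.symm.trans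
    (congrArg A.obj.q (cross_translations_fst A B d h))

/-- The second component of `ζ (e, d)` is `|d'|⁻¹ ▷ e`, in terms of the inverse degree of the first
component `d'`. -/
theorem cross_snd {E : Rep M} (e : E.carrier) (d : A.obj.carrier) (h : E.q e = A.obj.p d) :
    (cross A E e d h).1.2 = E.action.act
      (invDeg A (E.p e) (cross A E e d h).1.1 (p_cross A e d h).symm) e
        (tgt_invDeg A _ _ _) := by
  have h0 : E.action.act (Arr.one H (E.p e)) e rfl = e := E.action.one_act e
  have hd : (free E e).q (freeGen E e) = A.obj.p d := (congrArg E.q h0).trans h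
  -- Crossing commutes with the inclusion of the points `(x, x ▷ e)`, which contain `(1, e)`.
  have h1 := cross_map A (freeGraph E e) (freeGen E e) d hd
  have h2 : (freeGraph E e).hom.toFun (freeGen E e) =
      ⟨(freeGen (𝟙_ (Rep M)) (E.p e), e), rfl⟩ := tensor_ext rfl h0
  have h3 := ((cross_congr A h2 rfl _).symm.trans h1).symm.trans
    (cross_tensor A (E := translations M (E.p e)) (freeGen (𝟙_ (Rep M)) (E.p e)) e rfl d h)
  have hx := congrArg (fun w => w.1.2.1.1.1) h3
  have he := congrArg (fun w => w.1.2.1.2) h3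
  exact he.symm.trans (E.action.congr hx rfl _)

/-- The identity `|d|⁻¹ = |g ▷ d|⁻¹ ◁ g`. It compares two ways to cross the point `(g, 1)` of
`arrows M ⊗ translations M B` with `d`: factor by factor, and by `cross_snd`. -/
theorem invDeg_eq (g : Arr V) (d : A.obj.carrier) (h : g.tgt = A.obj.p d) :
    invDeg A g.tgt d h = M.right.act
      (invDeg A g.src (actOn A g d h) (p_cross A (E := arrows M) g d h).symm) g
        (tgt_invDeg A _ _ _) := by
  let t : (arrows M ⊗ translations M g.tgt).carrier := ⟨(g, freeGen (𝟙_ (Rep M)) g.tgt), rfl⟩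
  have h1 := cross_tensor A (E := arrows M) (F := translations M g.tgt) g
    (freeGen (𝟙_ (Rep M)) g.tgt) rfl d h
  have hb : (cross A (arrows M ⊗ translations M g.tgt) t d h).1.1 = actOn A g d h :=
    (congrArg (fun w => w.1.1) h1).trans (congrArg (fun w => w.1.1)
      (cross_congr A (E := arrows M) rfl (cross_translations_fst A g.tgt d h) _))
  have h2 := (congrArg (fun w => w.1.2) h1).symm.trans
    (cross_snd A (E := arrows M ⊗ translations M g.tgt) t d h)
  refine (congrArg (fun w => w.1.2.1) h2).trans ?_
  exact (Arr.mul_congr (M.right.congr (invDeg_congr A rfl hb _) rfl _) rfl _).trans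
    (Arr.mul_one _ (M.right.q_act _ _ _))

/-- The representation of the dual matched pair carried by an object `(D, ζ)` of the centralizer:
`g ▷ d` is the first component of `ζ (g, d)`, for `g` in the terminal representation `V`, and `|d|`
is inverse to the translation to which `ζ` carries an identity of `H` when it crosses `d`. -/
def toRep : Rep M.dual where
  toQuivOver := A.obj
  action :=
    { act := actOn A
      p_act := p_cross A (E := arrows M)
      act_act := fun g k d hgk h => by
        have h' : ((arrows M ⊗ arrows M).deg ⟨(g, k), hgk⟩).tgt = A.obj.p d := h
        exact (congrArg (fun w => w.1.1) (cross_tensor A (E := arrows M) (F := arrows M)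
          g k hgk d h)).symm.trans (cross_fst A (E := arrows M ⊗ arrows M) ⟨(g, k), hgk⟩ d h')
      one_act := fun d => (cross_fst A (E := 𝟙_ (Rep M)) (A.obj.p d) d rfl).symm.trans
        (congrArg (fun w => w.1.1) (cross_unit A (A.obj.p d) d rfl)) }
  deg d := (invDeg A (A.obj.p d) d rfl).inv
  p_eq d := (tgt_invDeg A (A.obj.p d) d rfl).symm
  q_eq d := (src_invDeg A (A.obj.p d) d rfl).symm
  deg_act g d h := by
    have hp : A.obj.p (actOn A g d h) = g.src := p_cross A (E := arrows M) g d h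
    have h1 : M.right.act (invDeg A (A.obj.p d) d rfl) g.inv
        ((tgt_invDeg A _ _ _).trans h.symm) = invDeg A _ (actOn A g d h) rfl :=
      (M.right.congr ((invDeg_congr A h.symm rfl _).trans (invDeg_eq A g d h)) rfl _).trans
        (((M.right.act_act _ g g.inv (tgt_invDeg A _ _ _) rfl).trans
          (M.right.congr rfl g.mul_inv _)).trans ((M.right_one _ (tgt_invDeg A _ _ _)).trans
            (invDeg_congr A hp.symm rfl _)))
    exact congrArg Arr.inv (h1.symm.trans (M.right.congr (Arr.inv_inv _).symm rfl _))

/-- The crossings with the reconstructed representation are the given `ζ`. -/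
theorem crossing_toRep (E : Rep M) : crossing E (toRep A) = (A.ζ E).hom := by
  refine QuivOver.hom_ext _ _ fun z => ?_
  have h1 := cross_fst A z.1.1 z.1.2 z.2
  refine tensor_ext h1.symm (Eq.trans ?_ (cross_snd A z.1.1 z.1.2 z.2).symm)
  exact E.action.congr ((Arr.inv_inv _).trans (invDeg_congr A
    ((congrArg A.obj.p h1).symm.trans (p_cross A z.1.1 z.1.2 z.2)) h1.symm rfl)) rfl _

end Reconstruction

/-! ### The strict monoidal equivalence -/

section Equivalence

variable {M : MatchedPair V H}

/-- The object of the centralizer given by the crossings with a representation of the dual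
matched pair. -/
def ofRep (D : Rep M.dual) : Centralizer (Rep.forget M) where
  obj := D.toQuivOver
  ζ E := crossingIso E D
  naturality f := crossing_naturality_left f D
  tensor E F := crossing_tensor_left E F D
  unit := crossing_unit_left D

variable (M) in
/-- Representations of the dual matched pair as objects of the centralizer. -/
def centralizerFunctor : Rep M.dual ⥤ Centralizer (Rep.forget M) where
  obj := ofRep
  map f := { hom := f.hom, comm := fun E => crossing_naturality_right E f }

theorem cross_hom {A B : Centralizer (Rep.forget M)} (f : A ⟶ B) (E : Rep M) (e : E.carrier)
    (d : A.obj.carrier) (h : E.q e = A.obj.p d) :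
    cross B E e (f.hom.toFun d) (h.trans (f.hom.p_comm d).symm) =
      ⟨(f.hom.toFun (cross A E e d h).1.1, (cross A E e d h).1.2),
        (f.hom.q_comm _).trans (cross A E e d h).2⟩ :=
  congrFun (congrArg QuivOver.Hom.toFun (f.comm E)) ⟨(e, d), h⟩

variable (M) in
/-- Objects of the centralizer as representations of the dual matched pair. -/
def toRepFunctor : Centralizer (Rep.forget M) ⥤ Rep M.dual where
  obj := toRep
  map {A B} f :=
    { hom := f.hom
      map_act := fun g d h => (congrArg (fun w => w.1.1) (cross_hom f (arrows M) g d h)).symm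
      map_deg := fun d => by
        refine congrArg Arr.inv ((invDeg_congr B (f.hom.p_comm d) rfl _).trans ?_)
        exact congrArg (fun w => w.1.2.1) (cross_hom f (translations M (A.obj.p d))
          (freeGen (𝟙_ (Rep M)) (A.obj.p d)) d rfl) }

/-- A representation of the dual matched pair is recovered from its crossings. -/
def unitIsoApp (D : Rep M.dual) : D ≅ toRep (ofRep D) :=
  Rep.isoMk (Iso.refl D.toQuivOver) (fun _ _ _ => rfl) (fun d => by
    have h1 : D.action.act (Arr.one V (D.p d)) d rfl = d := D.action.one_act d
    have h2 : invDeg (ofRep D) (D.p d) d rfl = (D.deg d).inv :=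
      (Arr.mul_one (D.deg (D.action.act (Arr.one V (D.p d)) d rfl)).inv
        ((D.p_eq _).symm.trans (D.action.p_act _ _ rfl))).trans
      (congrArg (fun d => (D.deg d).inv) h1)
    exact (congrArg Arr.inv h2).trans (Arr.inv_inv _))

/-- An object of the centralizer is given by the crossings with its reconstructed representation. -/
def counitIsoApp (A : Centralizer (Rep.forget M)) : ofRep (toRep A) ≅ A :=
  Centralizer.isoMk (Iso.refl A.obj) (fun E => (crossing_toRep A E).symm)

variable (M) in
/-- The equivalence between representations of the dual matched pair and the centralizer. -/
def centralizerEquivalence : Rep M.dual ≌ Centralizer (Rep.forget M) where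
  functor := centralizerFunctor M
  inverse := toRepFunctor M
  unitIso := NatIso.ofComponents unitIsoApp (fun _ => rfl)
  counitIso := NatIso.ofComponents counitIsoApp (fun _ => rfl)
  functor_unitIso_comp _ := rfl

/-- The tensor product of representations corresponds to that of the centralizer. -/
def ofRepTensorIso (D D' : Rep M.dual) : ofRep D ⊗ ofRep D' ≅ ofRep (D ⊗ D') :=
  Centralizer.isoMk (Iso.refl (D.toQuivOver ⊗ D'.toQuivOver))
    (fun E => crossing_tensor_right E D D')

variable (M) in
/-- The unit representation corresponds to the unit of the centralizer. -/
def ofRepUnitIso : 𝟙_ (Centralizer (Rep.forget M)) ≅ ofRep (𝟙_ (Rep M.dual)) :=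
  Centralizer.isoMk (Iso.refl (𝟙_ (QuivOver P))) (fun E => crossing_unit_right E)

variable (M) in
/-- All structural isomorphisms lie over identities of quivers. -/
def centralizerFunctorCoreMonoidal : (centralizerFunctor M).CoreMonoidal where
  εIso := ofRepUnitIso M
  μIso := ofRepTensorIso
  μIso_hom_natural_left _ _ := rfl
  μIso_hom_natural_right _ _ := rfl
  associativity _ _ _ := rfl
  left_unitality _ := rfl
  right_unitality _ := rfl

instance : (centralizerFunctor M).Monoidal := (centralizerFunctorCoreMonoidal M).toMonoidal

instance : (centralizerEquivalence M).functor.Monoidal :=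
  inferInstanceAs (centralizerFunctor M).Monoidal

theorem centralizerFunctor_isStrictMonoidal : IsStrictMonoidal (centralizerFunctor M) :=
  have hu : 𝟙_ (Centralizer (Rep.forget M)) = ofRep (𝟙_ (Rep M.dual)) :=
    Centralizer.eq_of_hom rfl (ofRepUnitIso M).hom rfl
  have ht (D D' : Rep M.dual) : ofRep D ⊗ ofRep D' = ofRep (D ⊗ D') :=
    Centralizer.eq_of_hom rfl (ofRepTensorIso D D').hom rfl
  { unit_obj := hu
    ε_eq := Centralizer.hom_eq_eqToHom hu _ rfl
    tensor_obj := ht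
    μ_eq := fun D D' => Centralizer.hom_eq_eqToHom (ht D D') _ rfl }

/-- The monoidal structure on the inverse, transported along the equivalence. -/
noncomputable instance : (centralizerEquivalence M).inverse.Monoidal :=
  (centralizerEquivalence M).inverseMonoidal

instance : (centralizerEquivalence M).IsMonoidal where
  leftAdjoint_ε := rfl
  leftAdjoint_μ _ _ := rfl

theorem centralizerEquivalence_inverse_isStrictMonoidal :
    IsStrictMonoidal (centralizerEquivalence M).inverse :=
  have hu : 𝟙_ (Rep M.dual) = toRep (𝟙_ (Centralizer (Rep.forget M))) :=
    Rep.eq_of_hom rfl (Functor.LaxMonoidal.ε (centralizerEquivalence M).inverse) rfl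
  have ht (A B : Centralizer (Rep.forget M)) : toRep A ⊗ toRep B = toRep (A ⊗ B) :=
    Rep.eq_of_hom rfl (Functor.LaxMonoidal.μ (centralizerEquivalence M).inverse A B) rfl
  { unit_obj := hu
    ε_eq := Rep.hom_eq_eqToHom hu _ rfl
    tensor_obj := ht
    μ_eq := fun A B => Rep.hom_eq_eqToHom (ht A B) _ rfl }

end Equivalence

end MatchedPairs

theorem corollary3 {P : Type u} {V H : CategoryTheory.Groupoid.{u} P}
    (M : MatchedPairs.MatchedPair V H) :
    ∃ e : CategoryTheory.StrictMonoidalEquivalence (MatchedPairs.Rep M.dual)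
        (CategoryTheory.Centralizer (MatchedPairs.Rep.forget M)),
      CategoryTheory.Functor.comp e.equiv.functor
          (CategoryTheory.Centralizer.forget (MatchedPairs.Rep.forget M)) =
        MatchedPairs.Rep.forget M.dual := by
  exact ⟨{
    equiv := MatchedPairs.centralizerEquivalence M
    functorMonoidal := inferInstance
    inverseMonoidal := inferInstance
    isMonoidal := inferInstance
    functor_strict := MatchedPairs.centralizerFunctor_isStrictMonoidal
    inverse_strict := MatchedPairs.centralizerEquivalence_inverse_isStrictMonoidal }, rfl⟩
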